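/- For $n\ge 0$ let $K_{1,n}$ be the star graph with one centre and $n$ leaves, i.e. the join of the complete graph on one node and the graph on $n$ nodes without edges, and let $B_n$ be its graphical building set, consisting of all nonempty sets $S$ of nodes whose induced subgraph is connected. The $n$-dimensional stellohedron is the Minkowski sum $St^n=\sum_{S\in B_n}\Delta_S\subset\mathbb{R}^{n+1}$, where $\Delta_S=\mathrm{conv}\{e_i : i\in S\}$. For a polytope $P$ of dimension $n$ with $f_k$ faces of dimension $k$ (where $f_n=1$) put $f(P)(\alpha,t)=\sum_{k=0}^n f_k\,\alpha^k t^{n-k}$ and $h(P)(\alpha,t)=f(P)(\alpha-t,t)$. If $h(P)(\alpha,t)=\sum_{0\le i\le n/2}\gamma_i\,(\alpha t)^i(\alpha+t)^{n-2i}$, then the (uniquely determined) polynomial $\gamma(P)(\tau)=\sum_i\gamma_i\tau^i$ is called the $\gamma$-polynomial of $P$. Grade formal power series over $\mathbb{Q}[\alpha,t]$ in the variable $x$, or in the variables $x,y$, by $\deg\alpha=\deg t=-2$ and $\deg x=\deg y=2$. Such a series $\psi$ is a Gal series if (1) it is symmetric in $\alpha$ and $t$; (2) it is homogeneous; (3)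 written as a series $\hat\psi$ over $\mathbb{Q}[a,b]$ with $a=\alpha+t$, $b=\alpha t$, it has only non-negative coefficients. **Theorem.** The series $$P_{\nabla^1,\because;h}(\alpha,t,x,y)=y\sum_{n\ge0}h(St^n)(\alpha,t)\,\frac{x^n}{n!}$$ and $$St_h(\alpha,t,x)=\sum_{n\ge0}h(St^n)(\alpha,t)\,\frac{x^n}{n!}$$ are Gal series. Consequently every stellohedron satisfies Gal's conjecture: for every $n\ge0$ the $\gamma$-polynomial of $St^n$ exists and has non-negative integer coefficients. -/

import Mathlib

open scoped Pointwise Nat Polynomial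

namespace Nestohedra

noncomputable section

/-! ### Graphs -/

/-- The join of two graphs: their disjoint union together with all the edges between them. -/
def graphJoin {V W : Type*} (G : SimpleGraph V) (H : SimpleGraph W) : SimpleGraph (V ⊕ W) :=
  (G ⊕g H) ⊔ completeBipartiteGraph V W

/-- The join of the complete graph on `k` nodes and the graph on `l` nodes without edges. -/
def completeJoinEmpty (k l : ℕ) : SimpleGraph (Fin k ⊕ Fin l) :=
  graphJoin (⊤ : SimpleGraph (Fin k)) (⊥ : SimpleGraph (Fin l))

/-! ### Building sets and nestohedra -/

/-- A building set on a finite ground set `V`: a set of nonempty subsets of `V` that contains all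
singletons and contains the union of any two of its members that meet. -/
structure BuildingSet (V : Type*) [Fintype V] [DecidableEq V] where
  sets : Finset (Finset V)
  nonempty_of_mem : ∀ S ∈ sets, S.Nonempty
  union_mem : ∀ S ∈ sets, ∀ T ∈ sets, (S ∩ T).Nonempty → S ∪ T ∈ sets
  singleton_mem : ∀ v : V, {v} ∈ sets

open Classical in
/-- The graphical building set of `G`: all nonempty sets of nodes on which `G` induces a connected
graph (`SimpleGraph.Connected` includes that there is a node). -/
def graphicalBuildingSet {V : Type*} [Fintype V] [DecidableEq V] (G : SimpleGraph V) :
    BuildingSet V where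
  sets := Finset.univ.filter fun S => (G.induce (S : Set V)).Connected
  nonempty_of_mem := by
    intro S hS
    rw [Finset.mem_filter] at hS
    obtain ⟨⟨v, hv⟩⟩ := hS.2.nonempty
    exact ⟨v, hv⟩
  union_mem := by
    intro S hS T hT hST
    rw [Finset.mem_filter] at hS hT ⊢
    refine ⟨Finset.mem_univ _, ?_⟩
    have h := SimpleGraph.induce_union_connected hS.2.preconnected hT.2.preconnected
      (by simpa [← Finset.coe_inter] using hST)
    rwa [Finset.coe_union]
  singleton_mem := by
    intro v
    rw [Finset.mem_filter]
    refine ⟨Finset.mem_univ _, ?_⟩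
    have : Subsingleton ((({v} : Finset V) : Set V) : Type _) := by
      rw [Finset.coe_singleton]; infer_instance
    have : Nonempty ((({v} : Finset V) : Set V) : Type _) := ⟨⟨v, by simp⟩⟩
    exact ⟨SimpleGraph.Preconnected.of_subsingleton⟩

/-- The simplex `Δ_S`, the convex hull of the unit vectors `e_i`, `i ∈ S`. -/
def simplexOn {V : Type*} [DecidableEq V] (S : Finset V) : Set (V → ℝ) :=
  convexHull ℝ ((fun i : V => (Pi.single i 1 : V → ℝ)) '' (S : Set V))

/-- The nestohedron of a building set `B`: the Minkowski sum of the simplices `Δ_S`, `S ∈ B`. -/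
def nestohedron {V : Type*} [Fintype V] [DecidableEq V] (B : BuildingSet V) : Set (V → ℝ) :=
  ∑ S ∈ B.sets, simplexOn S

/-- The nestohedron of the join of the complete graph on `k` nodes and the empty graph on `l`
nodes. -/
def joinNestohedron (k l : ℕ) : Set (Fin k ⊕ Fin l → ℝ) :=
  nestohedron (graphicalBuildingSet (completeJoinEmpty k l))

/-- The `n`-dimensional stellohedron: the nestohedron of the star graph with one centre and
`n` leaves. -/
def stellohedron (n : ℕ) : Set (Fin 1 ⊕ Fin n → ℝ) :=
  joinNestohedron 1 n

/-! ### Face polynomials of polytopes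

In the polynomial ring `MvPolynomial (Fin 2) R` used here, `X 0` stands for `α` and `X 1` for `t`.
The definitions are applied to convex polytopes (given as subsets of a finite-dimensional real
vector space) only. -/

section Polytope

variable {V : Type*}

/-- The dimension of (the affine hull of) a nonempty set. -/
def polyDim (P : Set (V → ℝ)) : ℕ :=
  Module.finrank ℝ (vectorSpan ℝ P)

/-- The `k`-dimensional faces of a polytope `P`, the polytope itself being a face. -/
def facesOfDim (P : Set (V → ℝ)) (k : ℕ) : Set (Set (V → ℝ)) :=
  {F | F.Nonempty ∧ IsExposed ℝ P F ∧ polyDim F = k}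

/-- The `f`-polynomial `∑ f_k α ^ k t ^ (n - k)`, where `n = dim P` and `f_k` is the number of
`k`-dimensional faces. -/
def fPoly (P : Set (V → ℝ)) : MvPolynomial (Fin 2) ℤ :=
  ∑ k ∈ Finset.range (polyDim P + 1),
    MvPolynomial.C ((facesOfDim P k).ncard : ℤ) *
      MvPolynomial.X 0 ^ k * MvPolynomial.X 1 ^ (polyDim P - k)

/-- The `h`-polynomial `h(α, t) = f(α - t, t)`. -/
def hPoly (P : Set (V → ℝ)) : MvPolynomial (Fin 2) ℤ :=
  MvPolynomial.aeval ![MvPolynomial.X 0 - MvPolynomial.X 1, MvPolynomial.X 1] (fPoly P)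

/-- `γ` is the `γ`-polynomial of `P`: with `n = dim P` one has
`h(α, t) = ∑ γ_i (α t) ^ i (α + t) ^ (n - 2 i)`, the sum being over `i ≤ n / 2`. -/
def IsGammaPoly (P : Set (V → ℝ)) (γ : ℤ[X]) : Prop :=
  2 * γ.natDegree ≤ polyDim P ∧
    hPoly P = ∑ i ∈ Finset.range (polyDim P / 2 + 1),
      MvPolynomial.C (γ.coeff i) * (MvPolynomial.X 0 * MvPolynomial.X 1) ^ i *
        (MvPolynomial.X 0 + MvPolynomial.X 1) ^ (polyDim P - 2 * i)

/-- The conclusion of Gal's conjecture for `P`: the `γ`-polynomial exists and its coefficients are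
non-negative. -/
def SatisfiesGal (P : Set (V → ℝ)) : Prop :=
  ∃ γ : ℤ[X], IsGammaPoly P γ ∧ ∀ i, 0 ≤ γ.coeff i

end Polytope

/-! ### Gal series -/

/-- A Gal series in `ℚ[α, t][[x_s : s ∈ σ]]`, with `α = X 0` and `t = X 1`. The grading has
`deg α = deg t = -2` and `deg x_s = 2` for all `s`. -/
structure IsGalSeries {σ : Type*} (ψ : MvPowerSeries σ (MvPolynomial (Fin 2) ℚ)) : Prop where
  /-- `ψ(α, t, x) = ψ(t, α, x)`. -/
  symmetric : MvPowerSeries.map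
    (MvPolynomial.rename (R := ℚ) (Equiv.swap (0 : Fin 2) 1)).toRingHom ψ = ψ
  /-- All monomials that occur in `ψ` have the same degree. -/
  homogeneous : ∃ d : ℤ, ∀ (m : σ →₀ ℕ) (p : Fin 2 →₀ ℕ),
    MvPolynomial.coeff p (MvPowerSeries.coeff m ψ) ≠ 0 →
      2 * (m.degree : ℤ) - 2 * (p.degree : ℤ) = d
  /-- `ψ(α, t, x) = ψ'(a, b, x)` with `a = α + t`, `b = α t`, where all the coefficients of `ψ'`
  are non-negative. -/
  nonneg : ∃ ψ' : MvPowerSeries σ (MvPolynomial (Fin 2) ℚ),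
    MvPowerSeries.map (MvPolynomial.aeval (R := ℚ)
      ![(MvPolynomial.X 0 + MvPolynomial.X 1 : MvPolynomial (Fin 2) ℚ),
        MvPolynomial.X 0 * MvPolynomial.X 1]).toRingHom ψ' = ψ ∧
    ∀ (m : σ →₀ ℕ) (p : Fin 2 →₀ ℕ),
      0 ≤ MvPolynomial.coeff p (MvPowerSeries.coeff m ψ')

/-- `h(St^n)(α, t) / n!` as a polynomial over `ℚ`. -/
def stelloCoeff (n : ℕ) : MvPolynomial (Fin 2) ℚ :=
  MvPolynomial.C (1 / (n ! : ℚ)) *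
    MvPolynomial.map (Int.castRingHom ℚ) (hPoly (stellohedron n))

/-- `St_h(α, t, x) = ∑ h(St^n)(α, t) x ^ n / n!`. -/
def stelloSeries : PowerSeries (MvPolynomial (Fin 2) ℚ) :=
  PowerSeries.mk stelloCoeff

/-- The part belonging to one complete node of the two-variable generating series of the joins of
complete and empty graphs, `∑ h(P(∇^1, ∵^n))(α, t) (x ^ n / n!) (y ^ 1 / 1!)`;
the variable `x` has index `0` and `y` has index `1`. -/
def stelloSeriesXY : MvPowerSeries (Fin 2) (MvPolynomial (Fin 2) ℚ) :=
  fun m => if m 1 = 1 then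
    MvPolynomial.C (1 / ((m 0)! : ℚ) * (1 / ((m 1)! : ℚ))) *
      MvPolynomial.map (Int.castRingHom ℚ) (hPoly (joinNestohedron 1 (m 0)))
    else 0

end

end Nestohedra

/-! A face of the stellohedron is where some functional `u` is maximal, and it depends only on how
`u` ranks the leaves relative to the centre: leaves below the centre are interchangeable, the others
form ordered levels. So faces correspond to functions `c` on the leaves with `0` for "below the
centre", `1` for the centre's level, and nonempty levels `2, …, m + 1`. The face has dimension `n -
m - z`, where `z` is the number of zeros (`polyDim_levelFace`, `levelFace_injOn`,
`exists_levelFace_eq`).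

Hence `f(St^n)` is the sum of `α ^ (n - m - z) * t ^ (m + z)`. For fixed `m` this is `surjSum α t t
n m`, whose recurrence inserts one leaf: below the centre (`t`), beside the centre (`α`), into one
of `m` existing upper levels (`α` each), or as a new level in one of `m` places (`t` each).

Positivity comes from binomial moments in `m`. They satisfy a three-term recurrence in `k`
(`surjMoment_succ`); after a factor `t ^ k` is removed, its coefficients are non-negative integer
combinations of `1`, `α + 2t` and `(α + t)t`. The substitution `α ↦ α - t` turns the last two into
`a = α + t` and `b = α t`. So `h(St^n)` is a polynomial in `a`, `b` with coefficients in `ℕ`, and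
weighted homogeneity puts it in the form required of a γ-expansion. -/

namespace Nestohedra

noncomputable section

/-! ### Recurrences for weighted level functions and their binomial moments -/

section Recurrences

variable {A : Type*} [CommRing A]

/-- The solution of `B (n + 1) m = (t + α + m α) B n m + m s B n (m - 1)` with `B 0 m = δ_{m 0}`. -/
def surjSum (α t s : A) : ℕ → ℕ → A
  | 0, m => if m = 0 then 1 else 0
  | n + 1, m => (t + α + m * α) * surjSum α t s n m + m * s * surjSum α t s n (m - 1)

theorem surjSum_eq_zero (α t s : A) (n : ℕ) : ∀ m, n < m → surjSum α t s n m = 0 := by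
  induction n with
  | zero => intro m hm; simp [surjSum, hm.ne']
  | succ n ih =>
    intro m hm
    rw [surjSum, ih m (by omega), ih (m - 1) (by omega)]
    ring

/-- The right side weighs all maps from `n` points to `m + 2` values, one of weight `t` and the
others of weight `α`; the left side sorts them by which of `m` distinguished values are hit. -/
theorem sum_choose_mul_surjSum (α t : A) (n m : ℕ) :
    ∑ k ∈ Finset.range (m + 1), (m.choose k : A) * surjSum α t α n k = (t + α + m * α) ^ n := by
  induction n with
  | zero =>
    rw [Finset.sum_range_succ']
    simp [surjSum]
  | succ n ih =>
    have key : ∑ k ∈ Finset.range (m + 1),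
        (m.choose k : A) * ((k : A) * α * surjSum α t α n (k - 1)) =
        ∑ k ∈ Finset.range (m + 1), (m.choose k : A) * (((m : A) - k) * α * surjSum α t α n k) := by
      rw [Finset.sum_range_succ', Finset.sum_range_succ]
      simp only [Nat.cast_zero, zero_mul, mul_zero, add_zero, sub_self]
      refine Finset.sum_congr rfl fun k hk => ?_
      have hk' : k ≤ m := (Finset.mem_range.1 hk).le
      have h := congrArg (Nat.cast : ℕ → A) (Nat.choose_succ_right_eq m k)
      push_cast [Nat.cast_sub hk'] at h
      simp only [Nat.add_sub_cancel]
      push_cast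
      linear_combination (α * surjSum α t α n k) * h
    simp only [surjSum, mul_add, Finset.sum_add_distrib] at key ⊢
    rw [key, pow_succ, ← ih, Finset.sum_mul, ← Finset.sum_add_distrib]
    refine Finset.sum_congr rfl fun k _ => ?_
    ring

/-- Each of the `m` upper levels is opened exactly once, so `s` enters only through a factor `s ^
m`. -/
theorem pow_mul_surjSum (α t : A) (n : ℕ) :
    ∀ m, α ^ m * surjSum α t t n m = t ^ m * surjSum α t α n m := by
  induction n with
  | zero => intro m; by_cases h : m = 0 <;> simp [surjSum, h]
  | succ n ih =>
    rintro (_ | m)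
    · have := ih 0
      simp only [surjSum] at this ⊢
      simp only [Nat.cast_zero]
      linear_combination (t + α) * this
    · have h1 := ih (m + 1)
      have h2 := ih m
      simp only [surjSum, Nat.add_sub_cancel]
      push_cast
      linear_combination (t + α + (m + 1) * α) * h1 + (m + 1) * t * α * h2

/-- The binomial moments of `surjSum α t t n`. -/
def surjMoment (α t : A) (n k : ℕ) : A :=
  ∑ m ∈ Finset.range (n + 1), (m.choose k : A) * surjSum α t t n m

/-- After the summation index is shifted, the factor `m + 1` is absorbed into binomial coefficients
by `e1` and `e2`, which keeps all coefficients positive. -/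
theorem surjMoment_succ (α t : A) (n k : ℕ) :
    surjMoment α t (n + 1) k = k * t * surjMoment α t n (k - 1) +
      (k + 1) * (α + 2 * t) * surjMoment α t n k +
      (k + 1) * (α + t) * surjMoment α t n (k + 1) := by
  have h1 : surjMoment α t (n + 1) k = ∑ m ∈ Finset.range (n + 1),
      ((m.choose k : A) * (t + α + m * α) + ((m + 1).choose k : A) * (m + 1) * t) *
        surjSum α t t n m := by
    rw [surjMoment]
    simp only [surjSum, mul_add, add_mul, Finset.sum_add_distrib]
    congr 1
    · rw [Finset.sum_range_succ, Finset.sum_range_succ _ (n + 1),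
        Finset.sum_range_succ _ (n + 1), surjSum_eq_zero α t t n (n + 1) (by omega)]
      simp only [mul_zero, add_zero, mul_assoc]
    · rw [Finset.sum_range_succ']
      simp only [Nat.add_sub_cancel, Nat.cast_zero, zero_mul, mul_zero, add_zero]
      rw [← Finset.sum_add_distrib]
      refine Finset.sum_congr rfl fun m _ => ?_
      push_cast
      ring
  rw [h1]
  simp only [surjMoment, Finset.mul_sum]
  rw [← Finset.sum_add_distrib, ← Finset.sum_add_distrib]
  refine Finset.sum_congr rfl fun m _ => ?_
  have e1 : ((m : A) + 1) * m.choose k = (k + 1) * (m.choose k + m.choose (k + 1)) := by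
    have := congrArg (Nat.cast : ℕ → A) (Nat.add_one_mul_choose_eq m k)
    rw [Nat.choose_succ_succ] at this
    push_cast at this
    linear_combination this
  have e2 : ((m : A) + 1) * (m + 1).choose k =
      k * m.choose (k - 1) + (k + (m + 1)) * m.choose k := by
    cases k with
    | zero => simp
    | succ k =>
      have := congrArg (Nat.cast : ℕ → A) (Nat.add_one_mul_choose_eq m k)
      rw [Nat.choose_succ_succ] at this ⊢
      push_cast at this ⊢
      linear_combination this
  linear_combination (t * surjSum α t t n m) * e2 + ((α + t) * surjSum α t t n m) * e1

end Recurrences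

/-! ### The polynomials in `a = α + t` and `b = α t` -/

/-- The polynomials in `a = X 0` and `b = X 1` given by
`Q (n + 1) k = k Q n (k - 1) + (k + 1) a Q n k + (k + 1) b Q n (k + 1)` and `Q 0 k = δ_{k 0}`. -/
def galPoly : ℕ → ℕ → MvPolynomial (Fin 2) ℕ
  | 0, k => if k = 0 then 1 else 0
  | n + 1, k => MvPolynomial.C k * galPoly n (k - 1) +
      MvPolynomial.C (k + 1) * MvPolynomial.X 0 * galPoly n k +
      MvPolynomial.C (k + 1) * MvPolynomial.X 1 * galPoly n (k + 1)

theorem galPoly_isWeightedHomogeneous (n : ℕ) : ∀ k,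
    (galPoly n k).IsWeightedHomogeneous (![1, 2] : Fin 2 → ℤ) ((n : ℤ) - k) := by
  induction n with
  | zero =>
    intro k
    by_cases h : k = 0
    · simpa [galPoly, h] using MvPolynomial.isWeightedHomogeneous_one ℕ (![1, 2] : Fin 2 → ℤ)
    · simpa [galPoly, h] using MvPolynomial.isWeightedHomogeneous_zero ℕ (![1, 2] : Fin 2 → ℤ) _
  | succ n ih =>
    intro k
    have hC (c : ℕ) := MvPolynomial.isWeightedHomogeneous_C (![1, 2] : Fin 2 → ℤ) c
    have hX (i : Fin 2) := MvPolynomial.isWeightedHomogeneous_X ℕ (![1, 2] : Fin 2 → ℤ) i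
    rw [galPoly]
    refine .add (.add ?_ ?_) ?_
    -- For `k = 0` the truncated index `k - 1` is harmless, as the factor `k` vanishes.
    · rcases k with _ | k
      · simpa using MvPolynomial.isWeightedHomogeneous_zero ℕ (![1, 2] : Fin 2 → ℤ) _
      · have := (hC (k + 1)).mul (ih k)
        simpa using this
    · have := ((hC (k + 1)).mul (hX 0)).mul (ih k)
      convert this using 1
      simp; ring
    · have := ((hC (k + 1)).mul (hX 1)).mul (ih (k + 1))
      convert this using 1
      simp; ring

/-- Extracting `t ^ k` moves a factor `t` from the down-step to the up-step of the moment
recurrence: `k t` becomes `k`, and `α + t` becomes `(α + t) t`. -/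
theorem surjMoment_eq_aeval_galPoly {A : Type*} [CommRing A] [Algebra ℕ A] (α t : A) (n : ℕ) : ∀ k,
    surjMoment α t n k =
      t ^ k * MvPolynomial.aeval ![α + 2 * t, (α + t) * t] (galPoly n k) := by
  induction n with
  | zero =>
    rintro (_ | k) <;> simp [surjMoment, surjSum, galPoly]
  | succ n ih =>
    intro k
    rw [surjMoment_succ, ih, ih, ih, galPoly]
    rw [map_add, map_add]
    simp only [map_mul, MvPolynomial.aeval_C, MvPolynomial.aeval_X, Matrix.cons_val_zero,
      Matrix.cons_val_one]
    simp only [eq_natCast, Nat.cast_add, Nat.cast_one]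
    rcases k with _ | k
    · simp; ring
    · simp only [Nat.add_sub_cancel]; push_cast; ring

theorem sum_surjSum_eq_aeval_galPoly {A : Type*} [CommRing A] [Algebra ℕ A] (α t : A) (n : ℕ) :
    ∑ m ∈ Finset.range (n + 1), surjSum α t t n m =
      MvPolynomial.aeval ![α + 2 * t, (α + t) * t] (galPoly n 0) := by
  simpa [surjMoment] using surjMoment_eq_aeval_galPoly α t n 0

/-! ### Faces of Minkowski sums of simplices -/

section MaxOn

variable {V : Type*}

theorem single_mem_simplexOn [DecidableEq V] {S : Finset V} {i : V} (hi : i ∈ S) :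
    (Pi.single i 1 : V → ℝ) ∈ simplexOn S :=
  subset_convexHull ℝ _ ⟨i, hi, rfl⟩

/-- The elements of `S` at which `u` is maximal. -/
def maxOn (u : V → ℝ) (S : Finset V) : Finset V :=
  {v ∈ S | ∀ w ∈ S, u w ≤ u v}

theorem mem_maxOn {u : V → ℝ} {S : Finset V} {v : V} :
    v ∈ maxOn u S ↔ v ∈ S ∧ ∀ w ∈ S, u w ≤ u v := by
  simp [maxOn]

theorem maxOn_nonempty (u : V → ℝ) {S : Finset V} (hS : S.Nonempty) : (maxOn u S).Nonempty := by
  obtain ⟨v, hv, h⟩ := S.exists_max_image u hS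
  exact ⟨v, mem_maxOn.2 ⟨hv, h⟩⟩

end MaxOn

section Faces

variable {V : Type*} [Fintype V]

/-- The points of `P` on which the functional with coefficients `u` is maximal. -/
def dirFace (u : V → ℝ) (P : Set (V → ℝ)) : Set (V → ℝ) :=
  {x ∈ P | ∀ y ∈ P, u ⬝ᵥ y ≤ u ⬝ᵥ x}

theorem dirFace_zero (P : Set (V → ℝ)) : dirFace 0 P = P := by
  simp [dirFace]

theorem isExposed_iff_exists_dirFace {P F : Set (V → ℝ)} (hF : F.Nonempty) :
    IsExposed ℝ P F ↔ ∃ u : V → ℝ, F = dirFace u P := by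
  classical
  constructor
  · intro h
    obtain ⟨l, hl⟩ := h hF
    obtain ⟨w, key⟩ : ∃ w : V → ℝ, ∀ x, l x = w ⬝ᵥ x := by
      refine ⟨fun i => l (Pi.single i 1), fun x => ?_⟩
      have := LinearMap.pi_apply_eq_sum_univ (l : (V → ℝ) →ₗ[ℝ] ℝ) x
      simp only [ContinuousLinearMap.coe_coe, smul_eq_mul] at this
      rw [this, dotProduct]
      refine Finset.sum_congr rfl fun i _ => ?_
      rw [mul_comm]
      congr 2
      ext j
      by_cases h : i = j
      · subst h; simp
      · simp [h, Ne.symm h]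
    exact ⟨w, by simp only [hl, dirFace, key]⟩
  · rintro ⟨u, rfl⟩ -
    refine ⟨LinearMap.toContinuousLinearMap (dotProductBilin ℝ ℝ u), ?_⟩
    rfl

/-- The functional is additive and the summands vary independently: replacing one summand by a
better point would improve the total. -/
theorem sum_mem_dirFace_iff {ι : Type*} {s : Finset ι} {A : ι → Set (V → ℝ)} {u : V → ℝ}
    {g : ι → V → ℝ} (hg : ∀ i ∈ s, g i ∈ A i) :
    ∑ i ∈ s, g i ∈ dirFace u (∑ i ∈ s, A i) ↔ ∀ i ∈ s, g i ∈ dirFace u (A i) := by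
  classical
  constructor
  · rintro ⟨-, h⟩ i hi
    refine ⟨hg i hi, fun y hy => ?_⟩
    have hmem : ∑ j ∈ s, Function.update g i y j ∈ ∑ j ∈ s, A j := by
      rw [Set.mem_finsetSum]
      refine ⟨Function.update g i y, fun {j} hj => ?_, rfl⟩
      by_cases hji : j = i
      · subst hji; simpa using hy
      · simpa [hji] using hg j hj
    have := h _ hmem
    rw [Finset.sum_update_of_mem hi, Finset.sdiff_singleton_eq_erase,
      ← Finset.add_sum_erase s g hi, dotProduct_add, dotProduct_add] at this
    linarith
  · intro h
    refine ⟨?_, fun y hy => ?_⟩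
    · rw [Set.mem_finsetSum]
      exact ⟨g, fun {i} hi => hg i hi, rfl⟩
    · rw [Set.mem_finsetSum] at hy
      obtain ⟨f, hf, rfl⟩ := hy
      rw [dotProduct_sum, dotProduct_sum]
      exact Finset.sum_le_sum fun i hi => (h i hi).2 _ (hf hi)

theorem dirFace_sum {ι : Type*} (s : Finset ι) (A : ι → Set (V → ℝ)) (u : V → ℝ) :
    (dirFace u (∑ i ∈ s, A i)) = ∑ i ∈ s, dirFace u (A i) := by
  ext x
  constructor
  · intro hx
    obtain ⟨g, hg, rfl⟩ := (Set.mem_finsetSum ..).1 hx.1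
    rw [sum_mem_dirFace_iff fun i hi => hg hi] at hx
    rw [Set.mem_finsetSum]
    exact ⟨g, fun {i} hi => hx i hi, rfl⟩
  · intro hx
    obtain ⟨g, hg, rfl⟩ := (Set.mem_finsetSum ..).1 hx
    exact (sum_mem_dirFace_iff fun i hi => (hg hi).1).2 fun i hi => hg hi

variable [DecidableEq V]

theorem mem_simplexOn_iff {S : Finset V} {x : V → ℝ} :
    x ∈ simplexOn S ↔ (∀ i, 0 ≤ x i) ∧ ∑ i, x i = 1 ∧ ∀ i ∉ S, x i = 0 := by
  constructor
  · intro hx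
    have hconv : Convex ℝ {x : V → ℝ | (∀ i, 0 ≤ x i) ∧ ∑ i, x i = 1 ∧ ∀ i ∉ S, x i = 0} := by
      rintro x ⟨hx0, hx1, hxS⟩ y ⟨hy0, hy1, hyS⟩ a b ha hb hab
      refine ⟨fun i => ?_, ?_, fun i hi => ?_⟩
      · have := hx0 i; have := hy0 i
        simp only [Pi.add_apply, Pi.smul_apply, smul_eq_mul]
        positivity
      · simp only [Pi.add_apply, Pi.smul_apply, smul_eq_mul, Finset.sum_add_distrib,
          ← Finset.mul_sum, hx1, hy1]
        linarith
      · simp [hxS i hi, hyS i hi]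
    refine convexHull_min ?_ hconv hx
    rintro _ ⟨i, hi, rfl⟩
    refine ⟨fun j => ?_, by simp, fun j hj => ?_⟩
    · by_cases h : j = i
      · subst h; simp
      · simp [h]
    · have : j ≠ i := by rintro rfl; exact hj hi
      simp [this]
  · rintro ⟨h0, h1, hS⟩
    have hsum : ∑ i ∈ S, x i = 1 := by
      rw [← h1]
      exact Finset.sum_subset (Finset.subset_univ _) fun i _ hi => hS i hi
    have hx : x = ∑ i ∈ S, x i • (Pi.single i 1 : V → ℝ) := by
      ext j
      by_cases hj : j ∈ S
      · simp [Finset.sum_apply, Pi.single_apply, hj]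
      · simp [Finset.sum_apply, Pi.single_apply, hj, hS j hj]
    rw [hx]
    exact (convex_convexHull ℝ _).sum_mem (fun i _ => h0 i) hsum fun i hi =>
      subset_convexHull ℝ _ ⟨i, hi, rfl⟩

/-- The uniform distribution on `S`. -/
def barycenter (S : Finset V) : V → ℝ := fun i => if i ∈ S then (S.card : ℝ)⁻¹ else 0

theorem barycenter_mem_simplexOn {S : Finset V} (hS : S.Nonempty) :
    barycenter S ∈ simplexOn S := by
  rw [mem_simplexOn_iff]
  refine ⟨fun i => ?_, ?_, fun i hi => by simp [barycenter, hi]⟩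
  · unfold barycenter; split_ifs <;> positivity
  · have : (S.card : ℝ) ≠ 0 := by exact_mod_cast hS.card_pos.ne'
    simp [barycenter, this]

/-- The barycentre has full support, so it serves below as a point that detects its simplex. -/
theorem subset_of_barycenter_mem {S T : Finset V} (hS : S.Nonempty)
    (h : barycenter S ∈ simplexOn T) : S ⊆ T := by
  intro i hi
  by_contra hiT
  have := (mem_simplexOn_iff.1 h).2.2 i hiT
  simp [barycenter, hi, hS.ne_empty] at this

/-- On the simplex the functional is a weighted mean of the values of `u` on `S`, maximal exactly
when all weight lies on the maximisers. -/
theorem dirFace_simplexOn (u : V → ℝ) {S : Finset V} (hS : S.Nonempty) :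
    dirFace u (simplexOn S) = simplexOn (maxOn u S) := by
  obtain ⟨v, hv⟩ := maxOn_nonempty u hS
  obtain ⟨hvS, hmax⟩ := mem_maxOn.1 hv
  have hle : ∀ y ∈ simplexOn S, ∀ i, u i * y i ≤ u v * y i := by
    intro y hy i
    obtain ⟨h0, -, hout⟩ := mem_simplexOn_iff.1 hy
    by_cases hi : i ∈ S
    · exact mul_le_mul_of_nonneg_right (hmax i hi) (h0 i)
    · simp [hout i hi]
  have hsum : ∀ y ∈ simplexOn S, ∑ i, u v * y i = u v := by
    intro y hy
    rw [← Finset.mul_sum, (mem_simplexOn_iff.1 hy).2.1, mul_one]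
  ext x
  constructor
  · rintro ⟨hx, h⟩
    obtain ⟨h0, h1, hout⟩ := mem_simplexOn_iff.1 hx
    refine mem_simplexOn_iff.2 ⟨h0, h1, fun i hi => ?_⟩
    by_cases hiS : i ∈ S
    · have hge := h _ (single_mem_simplexOn hvS)
      rw [dotProduct_single_one] at hge
      have heq : ∑ i, u i * x i = ∑ i, u v * x i :=
        le_antisymm (Finset.sum_le_sum fun i _ => hle x hx i) (by rw [hsum x hx]; exact hge)
      have hi' := (Finset.sum_eq_sum_iff_of_le fun i _ => hle x hx i).1 heq i (Finset.mem_univ i)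
      by_contra hne
      have : u i = u v := mul_right_cancel₀ hne hi'
      exact hi (mem_maxOn.2 ⟨hiS, by rwa [this]⟩)
    · exact hout i hiS
  · intro hx
    obtain ⟨h0, h1, hout⟩ := mem_simplexOn_iff.1 hx
    have hxS : x ∈ simplexOn S := mem_simplexOn_iff.2 ⟨h0, h1, fun i hi => hout i fun hi' =>
      hi (mem_maxOn.1 hi').1⟩
    refine ⟨hxS, fun y hy => ?_⟩
    have hx' : u ⬝ᵥ x = u v := by
      rw [← hsum x hxS]
      refine Finset.sum_congr rfl fun i _ => ?_
      by_cases hi : i ∈ maxOn u S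
      · obtain ⟨hiS, hi⟩ := mem_maxOn.1 hi
        rw [le_antisymm (hmax i hiS) (hi v hvS)]
      · simp [hout i hi]
    rw [hx', ← hsum y hy]
    exact Finset.sum_le_sum fun i _ => hle y hy i

theorem dirFace_nestohedron (u : V → ℝ) (B : BuildingSet V) :
    dirFace u (nestohedron B) = ∑ S ∈ B.sets, simplexOn (maxOn u S) := by
  rw [nestohedron, dirFace_sum]
  exact Finset.sum_congr rfl fun S hS => dirFace_simplexOn u (B.nonempty_of_mem S hS)

theorem dirFace_nestohedron_nonempty (u : V → ℝ) (B : BuildingSet V) :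
    (dirFace u (nestohedron B)).Nonempty := by
  rw [dirFace_nestohedron]
  refine ⟨∑ S ∈ B.sets, barycenter (maxOn u S), ?_⟩
  rw [Set.mem_finsetSum]
  exact ⟨_, fun {S} hS => barycenter_mem_simplexOn (maxOn_nonempty u (B.nonempty_of_mem S hS)), rfl⟩

/-- The sum of the barycentres of the summands of one face, if it lies in the other face, must do so
summand by summand. -/
theorem dirFace_nestohedron_eq_iff (u u' : V → ℝ) (B : BuildingSet V) :
    dirFace u (nestohedron B) = dirFace u' (nestohedron B) ↔
      ∀ S ∈ B.sets, maxOn u S = maxOn u' S := by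
  have key : ∀ u u' : V → ℝ, dirFace u (nestohedron B) = dirFace u' (nestohedron B) →
      ∀ S ∈ B.sets, maxOn u S ⊆ maxOn u' S := by
    intro u u' h S hS
    have hb (T : Finset V) (hT : T ∈ B.sets) :
        barycenter (maxOn u T) ∈ dirFace u (simplexOn T) := by
      rw [dirFace_simplexOn u (B.nonempty_of_mem T hT)]
      exact barycenter_mem_simplexOn (maxOn_nonempty u (B.nonempty_of_mem T hT))
    have hmem := (sum_mem_dirFace_iff fun T hT => (hb T hT).1).2 hb
    change _ ∈ dirFace u (nestohedron B) at hmem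
    rw [h] at hmem
    have := (sum_mem_dirFace_iff fun T hT => (hb T hT).1).1 hmem S hS
    rw [dirFace_simplexOn u' (B.nonempty_of_mem S hS)] at this
    exact subset_of_barycenter_mem (maxOn_nonempty u (B.nonempty_of_mem S hS)) this
  constructor
  · exact fun h S hS => (key u u' h S hS).antisymm (key u' u h.symm S hS)
  · intro h
    rw [dirFace_nestohedron, dirFace_nestohedron]
    exact Finset.sum_congr rfl fun S hS => by rw [h S hS]

/-! ### Dimension of a Minkowski sum of simplices -/

/-- The linear map sending the unit vector of `v` to that of `f v`. -/
def pushForward {W : Type*} [DecidableEq W] (f : V → W) : (V → ℝ) →ₗ[ℝ] (W → ℝ) :=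
  Fintype.linearCombination ℝ fun v => (Pi.single (f v) 1 : W → ℝ)

theorem pushForward_single {W : Type*} [DecidableEq W] (f : V → W) (v : V) :
    pushForward f (Pi.single v 1) = Pi.single (f v) 1 := by
  simp [pushForward]

theorem ker_pushForward_le {W : Type*} [DecidableEq W] (f : V → W) (p : Submodule ℝ (V → ℝ))
    (hp : ∀ i j, f i = f j → (Pi.single i 1 - Pi.single j 1 : V → ℝ) ∈ p) :
    LinearMap.ker (pushForward f) ≤ p := by
  intro x hx
  rw [LinearMap.mem_ker] at hx
  -- `ρ` picks one representative in each fibre of `f`. For `x` in the kernel the fibre sums vanish,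
  -- so moving all mass to representatives gives zero.
  let ρ : V → V := fun v => (⟨v, rfl⟩ : ∃ v', f v' = f v).choose
  have hρ : ∀ v, f (ρ v) = f v := fun v => (⟨v, rfl⟩ : ∃ v', f v' = f v).choose_spec
  have hρ' : ∀ v v', f v = f v' → ρ v = ρ v' := by
    intro v v' h
    simp only [ρ, h]
  have hzero : ∑ v, x v • (Pi.single (ρ v) 1 : V → ℝ) = 0 := by
    ext j
    by_cases hj : ρ j = j
    · have hxj := congrFun hx (f j)
      simp only [pushForward, Fintype.linearCombination_apply, Finset.sum_apply, Pi.smul_apply,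
        Pi.single_apply, Pi.zero_apply] at hxj ⊢
      refine Eq.trans ?_ hxj
      refine Finset.sum_congr rfl fun v _ => ?_
      have : j = ρ v ↔ f j = f v :=
        ⟨fun h => by rw [h, hρ], fun h => by rw [← hj, hρ' _ _ h]⟩
      simp only [this]
    · simp only [Finset.sum_apply, Pi.smul_apply, Pi.single_apply, Pi.zero_apply]
      refine Finset.sum_eq_zero fun v _ => ?_
      have : j ≠ ρ v := by
        rintro rfl
        exact hj (hρ' _ _ (hρ v))
      simp [this]
  have hx' : x = ∑ v, x v • (Pi.single v 1 - Pi.single (ρ v) 1 : V → ℝ) := by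
    simp only [smul_sub, Finset.sum_sub_distrib, hzero, sub_zero]
    ext j
    simp [Finset.sum_apply, Pi.single_apply]
  rw [hx']
  exact p.sum_mem fun v _ => p.smul_mem _ (hp _ _ (hρ v).symm)

theorem finrank_ker_pushForward {W : Type*} [Fintype W] [DecidableEq W] (f : V → W)
    (hf : Function.Surjective f) :
    Module.finrank ℝ (LinearMap.ker (pushForward f)) + Fintype.card W = Fintype.card V := by
  have hr : LinearMap.range (pushForward f) = ⊤ := by
    rw [eq_top_iff, ← (Pi.basisFun ℝ W).span_eq, Submodule.span_le]
    rintro _ ⟨w, rfl⟩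
    obtain ⟨v, rfl⟩ := hf w
    exact ⟨Pi.single v 1, by simp [pushForward_single]⟩
  have := LinearMap.finrank_range_add_finrank_ker (pushForward f)
  rw [hr, finrank_top, Module.finrank_fintype_fun_eq_card, Module.finrank_fintype_fun_eq_card]
    at this
  omega

theorem pushForward_of_mem_simplexOn {W : Type*} [DecidableEq W] (f : V → W) {S : Finset V}
    {v : V} (h : ∀ i ∈ S, f i = f v) {x : V → ℝ} (hx : x ∈ simplexOn S) :
    pushForward f x = Pi.single (f v) 1 := by
  obtain ⟨-, h1, hout⟩ := mem_simplexOn_iff.1 hx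
  have : pushForward f x = ∑ i, x i • (Pi.single (f v) 1 : W → ℝ) := by
    rw [pushForward, Fintype.linearCombination_apply]
    refine Finset.sum_congr rfl fun i _ => ?_
    by_cases hi : i ∈ S
    · rw [h i hi]
    · simp [hout i hi]
  rw [this, ← Finset.sum_smul, h1, one_smul]

/-- `f` sends each summand to a single point, so differences of points lie in its kernel; the
simplex edges already span that kernel. -/
theorem polyDim_sum_simplexOn {W : Type*} [Fintype W] [DecidableEq W] (B : Finset (Finset V))
    (M : Finset V → Finset V) (hM : ∀ S ∈ B, (M S).Nonempty) (f : V → W)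
    (hf : Function.Surjective f) (h₁ : ∀ S ∈ B, ∀ i ∈ M S, ∀ j ∈ M S, f i = f j)
    (h₂ : ∀ i j, f i = f j → i ≠ j → ∃ S ∈ B, i ∈ M S ∧ j ∈ M S) :
    polyDim (∑ S ∈ B, simplexOn (M S)) + Fintype.card W = Fintype.card V := by
  have hspan : vectorSpan ℝ (∑ S ∈ B, simplexOn (M S)) = LinearMap.ker (pushForward f) := by
    refine le_antisymm ?_ (ker_pushForward_le f _ fun i j hij => ?_)
    · rw [vectorSpan_def, Submodule.span_le]
      rintro _ ⟨x, hx, y, hy, rfl⟩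
      rw [Set.mem_finsetSum] at hx hy
      obtain ⟨g, hg, rfl⟩ := hx
      obtain ⟨g', hg', rfl⟩ := hy
      simp only [vsub_eq_sub, SetLike.mem_coe, LinearMap.mem_ker, map_sub, map_sum, sub_eq_zero]
      refine Finset.sum_congr rfl fun S hS => ?_
      obtain ⟨v, hv⟩ := hM S hS
      rw [pushForward_of_mem_simplexOn f (fun i hi => h₁ S hS i hi v hv) (hg hS),
        pushForward_of_mem_simplexOn f (fun i hi => h₁ S hS i hi v hv) (hg' hS)]
    · by_cases hne : i = j
      · simp [hne]
      obtain ⟨S, hS, hi, hj⟩ := h₂ i j hij hne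
      -- Two such points, for `k = i` and `k = j`, agree in every summand but `S`, so they differ by
      -- the wanted edge vector.
      have hmem : ∀ k ∈ M S, ∑ T ∈ B, Function.update (fun T => barycenter (M T)) S
          (Pi.single k 1) T ∈ ∑ T ∈ B, simplexOn (M T) := by
        intro k hk
        rw [Set.mem_finsetSum]
        refine ⟨_, fun {T} hT => ?_, rfl⟩
        by_cases hTS : T = S
        · subst hTS; simpa using single_mem_simplexOn hk
        · simpa [hTS] using barycenter_mem_simplexOn (hM T hT)
      have := vsub_mem_vectorSpan ℝ (hmem i hi) (hmem j hj)
      rw [Finset.sum_update_of_mem hS, Finset.sum_update_of_mem hS] at this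
      simpa using this
  rw [← finrank_ker_pushForward f hf, polyDim, hspan]

end Faces

/-! ### Counting level functions -/

/-- The functions `Fin n → {0, 1} ∪ J` whose range contains `J`. -/
def levelFns (n : ℕ) (J : Finset ℕ) : Finset (Fin n → ℕ) :=
  {c ∈ Fintype.piFinset fun _ => insert 0 (insert 1 J) | ∀ j ∈ J, ∃ i, c i = j}

theorem mem_levelFns {n : ℕ} {J : Finset ℕ} {c : Fin n → ℕ} :
    c ∈ levelFns n J ↔ (∀ i, c i = 0 ∨ c i = 1 ∨ c i ∈ J) ∧ ∀ j ∈ J, ∃ i, c i = j := by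
  simp [levelFns, Fintype.mem_piFinset]

section LevelSum

variable {A : Type*} [CommRing A] (α t : A)

/-- The sum over `levelFns n J` of the product of the weights `t` of the zeros and `α` of the other
values. -/
def levelSum (n : ℕ) (J : Finset ℕ) : A :=
  ∑ c ∈ levelFns n J, ∏ i, if c i = 0 then t else α

/-- Expand the power over all functions to `{0, 1} ∪ J` and sort them by the subset of `J` they hit.
-/
theorem sum_powerset_levelSum (n : ℕ) {J : Finset ℕ} (h0 : 0 ∉ J) (h1 : 1 ∉ J) :
    ∑ K ∈ J.powerset, levelSum α t n K = (t + α + J.card * α) ^ n := by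
  have hw : ∑ j ∈ insert 0 (insert 1 J), (if j = 0 then t else α) = t + α + J.card * α := by
    rw [Finset.sum_insert (by simp [h0]), Finset.sum_insert h1,
      Finset.sum_congr rfl fun j hj => if_neg (ne_of_mem_of_not_mem hj h0)]
    simp [add_assoc]
  have hp := Finset.prod_univ_sum (fun _ : Fin n => insert 0 (insert 1 J))
    (fun _ j => if j = 0 then t else α)
  rw [hw, Finset.prod_const, Finset.card_univ, Fintype.card_fin] at hp
  rw [hp, ← Finset.sum_fiberwise_of_maps_to (t := J.powerset)
    (g := fun c : Fin n → ℕ => J.filter fun j => ∃ i, c i = j)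
    fun c _ => Finset.mem_powerset.2 (Finset.filter_subset _ _)]
  refine Finset.sum_congr rfl fun K hK => Finset.sum_congr ?_ fun _ _ => rfl
  have hKJ := Finset.mem_powerset.1 hK
  ext c
  simp only [mem_levelFns, Finset.mem_filter, Fintype.mem_piFinset, Finset.mem_insert]
  constructor
  · rintro ⟨hc, hs⟩
    refine ⟨fun i => (hc i).imp_right (Or.imp_right fun h => hKJ h), ?_⟩
    ext j
    simp only [Finset.mem_filter]
    refine ⟨?_, fun hj => ⟨hKJ hj, hs j hj⟩⟩
    rintro ⟨hj, i, rfl⟩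
    rcases hc i with h | h | h
    · rw [h] at hj; exact absurd hj h0
    · rw [h] at hj; exact absurd hj h1
    · exact h
  · rintro ⟨hc, rfl⟩
    exact ⟨fun i => (hc i).imp_right (Or.imp_right fun h => Finset.mem_filter.2 ⟨h, i, rfl⟩),
      fun j hj => (Finset.mem_filter.1 hj).2⟩

/-- Both sides have the same sums over the subsets of every admissible `J`, which determines them by
induction on `J`. -/
theorem levelSum_eq_surjSum (n : ℕ) (J : Finset ℕ) :
    0 ∉ J → 1 ∉ J → levelSum α t n J = surjSum α t α n J.card := by
  induction J using Finset.strongInduction with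
  | H J ih =>
    intro h0 h1
    have e1 := sum_powerset_levelSum α t n h0 h1
    have e2 := sum_choose_mul_surjSum α t n J.card
    have e3 := Finset.sum_powerset_apply_card (fun k => surjSum α t α n k) (x := J)
    simp only [nsmul_eq_mul] at e3
    rw [← e2, ← e3, ← Finset.add_sum_erase _ _ (Finset.mem_powerset_self J),
      ← Finset.add_sum_erase _ (fun K : Finset ℕ => surjSum α t α n K.card)
        (Finset.mem_powerset_self J)] at e1
    rw [Finset.sum_congr rfl fun K hK => ?_] at e1
    · exact add_right_cancel e1
    · obtain ⟨hne, hK⟩ := Finset.mem_erase.1 hK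
      have hKJ := Finset.mem_powerset.1 hK
      exact ih K (Finset.ssubset_iff_subset_ne.2 ⟨hKJ, hne⟩) (fun h => h0 (hKJ h))
        fun h => h1 (hKJ h)

end LevelSum

/-- The functions `Fin n → {0, …, m + 1}` that take all the values `2, …, m + 1`. -/
def levels (n m : ℕ) : Finset (Fin n → ℕ) := levelFns n (Finset.Ico 2 (m + 2))

theorem mem_levels {n m : ℕ} {c : Fin n → ℕ} :
    c ∈ levels n m ↔ (∀ i, c i < m + 2) ∧ ∀ j, 2 ≤ j → j < m + 2 → ∃ i, c i = j := by
  rw [levels, mem_levelFns]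
  simp only [Finset.mem_Ico, and_imp]
  refine and_congr_left fun _ => forall_congr' fun i => ?_
  omega

/-- The number of zeros of `c`. -/
def zeros {n : ℕ} (c : Fin n → ℕ) : ℕ := (Finset.univ.filter fun i => c i = 0).card

theorem prod_weight {A : Type*} [CommRing A] (α t : A) {n : ℕ} (c : Fin n → ℕ) :
    ∏ i, (if c i = 0 then t else α) = t ^ zeros c * α ^ (n - zeros c) := by
  rw [Finset.prod_ite, Finset.prod_const, Finset.prod_const, zeros]
  congr 2
  have := Finset.card_filter_add_card_filter_not (s := Finset.univ) (fun i : Fin n => c i = 0)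
  rw [Finset.card_univ, Fintype.card_fin] at this
  omega

/-- All the level functions with some number of blocks. -/
def allLevels (n : ℕ) : Finset (Fin n → ℕ) :=
  (Finset.range (n + 1)).biUnion (levels n)

theorem sum_allLevels {A : Type*} [AddCommMonoid A] (n : ℕ) (f : (Fin n → ℕ) → A) :
    ∑ c ∈ allLevels n, f c = ∑ m ∈ Finset.range (n + 1), ∑ c ∈ levels n m, f c := by
  rw [allLevels, Finset.sum_biUnion]
  have key : ∀ m m' (c : Fin n → ℕ), c ∈ levels n m → c ∈ levels n m' → m' ≤ m := by
    intro m m' c h h'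
    by_contra hlt
    -- The top value `m' + 1` is attained, but exceeds the bound given by `m`.
    obtain ⟨i, hi⟩ := (mem_levels.1 h').2 (m' + 1) (by omega) (by omega)
    have := (mem_levels.1 h).1 i
    omega
  intro m _ m' _ hne
  refine Finset.disjoint_left.2 fun c h h' => hne ?_
  exact le_antisymm (key _ _ c h' h) (key _ _ c h h')

/-! ### The faces of the stellohedron -/

/-- The centre is adjacent to every leaf, while leaves are pairwise non-adjacent. -/
theorem mem_sets_star {n : ℕ} {S : Finset (Fin 1 ⊕ Fin n)} :
    S ∈ (graphicalBuildingSet (completeJoinEmpty 1 n)).sets ↔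
      Sum.inl 0 ∈ S ∨ ∃ v, S = {v} := by
  constructor
  · intro h
    by_contra! hcon
    obtain ⟨hc, hs⟩ := hcon
    obtain ⟨v, hv⟩ := BuildingSet.nonempty_of_mem _ S h
    obtain ⟨w, hw, hne⟩ : ∃ w ∈ S, w ≠ v := by
      by_contra! hall
      exact hs v (Finset.eq_singleton_iff_unique_mem.2 ⟨hv, hall⟩)
    have hconn := (by
      classical
      exact (Finset.mem_filter.1 h).2 :
        ((completeJoinEmpty 1 n).induce (S : Set (Fin 1 ⊕ Fin n))).Connected)
    have hbot : (completeJoinEmpty 1 n).induce (S : Set (Fin 1 ⊕ Fin n)) = ⊥ := by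
      ext ⟨x, hx⟩ ⟨y, hy⟩
      rcases x with x | x
      · rw [Subsingleton.elim x 0] at hx; exact absurd hx hc
      rcases y with y | y
      · rw [Subsingleton.elim y 0] at hy; exact absurd hy hc
      simp [completeJoinEmpty, graphJoin]
    rw [hbot] at hconn
    have := hconn.preconnected ⟨w, hw⟩ ⟨v, hv⟩
    rw [SimpleGraph.reachable_bot] at this
    exact hne (congrArg Subtype.val this)
  · rintro (h | ⟨v, rfl⟩)
    · classical
      refine Finset.mem_filter.2 ⟨Finset.mem_univ _, ?_⟩
      rw [SimpleGraph.connected_iff_exists_forall_reachable]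
      refine ⟨⟨Sum.inl 0, h⟩, ?_⟩
      rintro ⟨x | x, hx⟩
      · have : x = 0 := Subsingleton.elim _ _
        subst this
        exact SimpleGraph.Reachable.refl _
      · refine SimpleGraph.Adj.reachable ?_
        simp [completeJoinEmpty, graphJoin]
    · exact BuildingSet.singleton_mem _ v

theorem maxOn_singleton {V : Type*} (u : V → ℝ) (v : V) : maxOn u {v} = {v} := by
  ext w
  rw [mem_maxOn]
  simp only [Finset.mem_singleton, forall_eq]
  exact ⟨fun h => h.1, fun h => ⟨h, by rw [h]⟩⟩

/-- The sets `{centre, i, j}` suffice: any member containing the centre can be tested pairwise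
against them, and singletons carry no information. -/
theorem dirFace_stellohedron_eq_iff {n : ℕ} (u u' : Fin 1 ⊕ Fin n → ℝ) :
    dirFace u (stellohedron n) = dirFace u' (stellohedron n) ↔
      ∀ i j, (u (Sum.inl 0) ≤ u i ∧ u j ≤ u i) ↔ (u' (Sum.inl 0) ≤ u' i ∧ u' j ≤ u' i) := by
  rw [stellohedron, joinNestohedron, dirFace_nestohedron_eq_iff]
  constructor
  · intro h i j
    have := congrArg (i ∈ ·) (h {Sum.inl 0, i, j} (mem_sets_star.2 (Or.inl (by simp))))
    simpa [mem_maxOn] using this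
  · intro h S hS
    rcases mem_sets_star.1 hS with hc | ⟨v, rfl⟩
    · have key : ∀ u : Fin 1 ⊕ Fin n → ℝ, ∀ v, v ∈ maxOn u S ↔
          v ∈ S ∧ ∀ w ∈ S, u (Sum.inl 0) ≤ u v ∧ u w ≤ u v := by
        intro u v
        rw [mem_maxOn]
        exact and_congr_right fun _ =>
          ⟨fun h w hw => ⟨h _ hc, h w hw⟩, fun h w hw => (h w hw).2⟩
      ext v
      simp only [key, h]
    · rw [maxOn_singleton, maxOn_singleton]

/-- The function on the nodes of the star that is `c` on the leaves and `1` at the centre. -/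
def nodeLevel {n : ℕ} (c : Fin n → ℕ) : Fin 1 ⊕ Fin n → ℕ := Sum.elim (fun _ => 1) c

/-- The face of the stellohedron in the direction of a level function. -/
def levelFace {n : ℕ} (c : Fin n → ℕ) : Set (Fin 1 ⊕ Fin n → ℝ) :=
  dirFace (fun v => (nodeLevel c v : ℝ)) (stellohedron n)

/-- The simplices of the face join nodes of equal level at least `1`; a leaf of level `0` is never
maximal beside the centre and stays alone. This leaves `m + 1 + zeros c` classes among `n + 1`
nodes. -/
theorem polyDim_levelFace {n m : ℕ} {c : Fin n → ℕ} (hc : c ∈ levels n m) :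
    polyDim (levelFace c) + m + zeros c = n := by
  obtain ⟨hlt, hsurj⟩ := mem_levels.1 hc
  have hlt' : ∀ v, nodeLevel c v < m + 2 := by
    rintro (v | v)
    · simp [nodeLevel]
    · exact hlt v
  let f : Fin 1 ⊕ Fin n → Finset.Ico 1 (m + 2) ⊕ {v // nodeLevel c v = 0} := fun v =>
    if h : nodeLevel c v = 0 then Sum.inr ⟨v, h⟩
    else Sum.inl ⟨nodeLevel c v, Finset.mem_Ico.2 ⟨Nat.pos_of_ne_zero h, hlt' v⟩⟩
  have hf : ∀ i j, f i = f j ↔ i = j ∨ 1 ≤ nodeLevel c i ∧ nodeLevel c j = nodeLevel c i := by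
    intro i j
    by_cases hi : nodeLevel c i = 0 <;> by_cases hj : nodeLevel c j = 0
    · simp [f, hi, hj]
    · have : i ≠ j := by rintro rfl; exact hj hi
      simp [f, hi, hj, this]
    · have : i ≠ j := by rintro rfl; exact hi hj
      simp [f, hi, hj, this, eq_comm]
    · simp only [f, hi, hj, dite_false, Sum.inl.injEq, Subtype.mk.injEq]
      refine ⟨fun h => Or.inr ⟨by omega, h.symm⟩, ?_⟩
      rintro (rfl | h)
      · rfl
      · exact h.2.symm
  have hfs : Function.Surjective f := by
    rintro (⟨j, hj⟩ | ⟨v, hv⟩)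
    · obtain ⟨v, rfl⟩ : ∃ v, nodeLevel c v = j := by
        rw [Finset.mem_Ico] at hj
        by_cases h1 : j = 1
        · exact ⟨Sum.inl 0, h1.symm⟩
        · obtain ⟨i, hi⟩ := hsurj j (by omega) hj.2
          exact ⟨Sum.inr i, hi⟩
      have : nodeLevel c v ≠ 0 := by rw [Finset.mem_Ico] at hj; omega
      exact ⟨v, by simp [f, this]⟩
    · exact ⟨v, by simp [f, hv]⟩
  have hcard : Fintype.card {v // nodeLevel c v = 0} = zeros c := by
    rw [Fintype.card_subtype, Finset.card_filter, Fintype.sum_sum_type, zeros]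
    simp only [nodeLevel, Sum.elim_inl, Sum.elim_inr, one_ne_zero, if_false,
      Finset.sum_const_zero, zero_add]
    exact (Finset.card_filter _ _).symm
  have key := polyDim_sum_simplexOn (graphicalBuildingSet (completeJoinEmpty 1 n)).sets
    (maxOn fun v => (nodeLevel c v : ℝ))
    (fun S hS => maxOn_nonempty _ (BuildingSet.nonempty_of_mem _ S hS)) f hfs ?_ ?_
  · rw [← dirFace_nestohedron] at key
    change polyDim (levelFace c) + _ = _ at key
    rw [Fintype.card_sum, Fintype.card_sum, hcard, Fintype.card_coe, Nat.card_Ico,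
      Fintype.card_fin, Fintype.card_fin] at key
    omega
  · intro S hS i hi j hj
    rw [hf]
    rcases mem_sets_star.1 hS with h0 | ⟨v, rfl⟩
    · obtain ⟨hiS, hi⟩ := mem_maxOn.1 hi
      obtain ⟨hjS, hj⟩ := mem_maxOn.1 hj
      have e1 := hi _ h0
      have e2 := hi _ hjS
      have e3 := hj _ hiS
      simp only [Nat.cast_le] at e1 e2 e3
      exact Or.inr ⟨e1, le_antisymm e2 e3⟩
    · rw [maxOn_singleton, Finset.mem_singleton] at hi hj
      exact Or.inl (hi.trans hj.symm)
  · intro i j hij hne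
    obtain ⟨h1, h2⟩ := ((hf i j).1 hij).resolve_left hne
    refine ⟨{Sum.inl 0, i, j}, mem_sets_star.2 (Or.inl (by simp)), ?_, ?_⟩
    · rw [mem_maxOn]
      simp [h2]
      simpa [nodeLevel] using h1
    · rw [mem_maxOn]
      simp [h2]
      simpa [nodeLevel] using h1

theorem le_of_mem_levels {n m : ℕ} {c : Fin n → ℕ} (hc : c ∈ levels n m) : m ≤ n := by
  have := polyDim_levelFace hc
  omega

theorem mem_allLevels {n : ℕ} {c : Fin n → ℕ} : c ∈ allLevels n ↔ ∃ m, c ∈ levels n m := by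
  simp only [allLevels, Finset.mem_biUnion, Finset.mem_range]
  exact ⟨fun ⟨m, _, h⟩ => ⟨m, h⟩, fun ⟨m, h⟩ => ⟨m, by have := le_of_mem_levels h; omega, h⟩⟩

theorem levelFace_injOn (n : ℕ) : Set.InjOn (levelFace (n := n)) (allLevels n) := by
  have key : ∀ c ∈ allLevels n, ∀ c' : Fin n → ℕ, levelFace c = levelFace c' →
      ∀ k i, c i = k → k ≤ c' i := by
    intro c hc c' h
    obtain ⟨m, hm⟩ := mem_allLevels.1 hc
    obtain ⟨hlt, hsurj⟩ := mem_levels.1 hm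
    have h := (dirFace_stellohedron_eq_iff _ _).1 h
    simp only [Nat.cast_le] at h
    have h1 : ∀ i, 1 ≤ c i ↔ 1 ≤ c' i := fun i => by
      simpa [nodeLevel] using h (Sum.inr i) (Sum.inr i)
    have h2 : ∀ i, c i ≤ 1 ↔ c' i ≤ 1 := fun i => by
      simpa [nodeLevel] using h (Sum.inl 0) (Sum.inr i)
    have h3 : ∀ i j, (1 ≤ c i ∧ c j ≤ c i) ↔ (1 ≤ c' i ∧ c' j ≤ c' i) := fun i j => by
      simpa [nodeLevel] using h (Sum.inr i) (Sum.inr j)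
    intro k
    -- Comparison with the centre settles levels up to `2`. Above that, a leaf one level lower, to
    -- which induction applies, must also lie strictly lower under `c'`.
    induction k with
    | zero => intro i _; omega
    | succ k ih =>
      intro i hi
      have e1 := h1 i
      have e2 := h2 i
      by_cases hk : k < 2
      · omega
      · have := hlt i
        obtain ⟨j, hj⟩ := hsurj k (by omega) (by omega)
        have := ih j hj
        have := h3 j i
        have := h1 j
        omega
  intro c hc c' hc' h
  ext i
  exact le_antisymm (key c hc c' h _ i rfl) (key c' hc' c h.symm _ i rfl)

theorem exists_levelFace_eq {n : ℕ} (u : Fin 1 ⊕ Fin n → ℝ) :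
    ∃ c ∈ allLevels n, levelFace c = dirFace u (stellohedron n) := by
  classical
  -- `W` holds the values of `u` not below the centre's, and `r` ranks them from `0`. The centre has
  -- rank `0`, so adding `1` puts it on level `1` and gives `m = W.card - 1`.
  let W : Finset ℝ := (Finset.univ.image u).filter (u (Sum.inl 0) ≤ ·)
  let r : ℝ → ℕ := fun x => (W.filter (· < x)).card
  have hW : ∀ v, u (Sum.inl 0) ≤ u v → u v ∈ W := fun v hv => by simpa [W] using hv
  have hr : ∀ x ∈ W, ∀ y, x < y → r x < r y := by
    intro x hx y hxy
    refine Finset.card_lt_card (Finset.ssubset_iff_subset_ne.2 ⟨?_, ?_⟩)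
    · intro z hz
      rw [Finset.mem_filter] at hz ⊢
      exact ⟨hz.1, hz.2.trans hxy⟩
    · intro h
      have : x ∈ W.filter (· < y) := Finset.mem_filter.2 ⟨hx, hxy⟩
      rw [← h, Finset.mem_filter] at this
      exact lt_irrefl _ this.2
  have hr' : ∀ x ∈ W, ∀ y ∈ W, x ≤ y ↔ r x ≤ r y := by
    intro x hx y hy
    constructor
    · intro h
      rcases h.eq_or_lt with rfl | h
      · rfl
      · exact (hr x hx y h).le
    · intro h
      by_contra! hlt
      exact absurd (hr y hy x hlt) (by omega)
  have hrlt : ∀ x ∈ W, r x < W.card := by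
    intro x hx
    refine Finset.card_lt_card (Finset.filter_ssubset.2 ⟨x, hx, lt_irrefl x⟩)
  have hrsurj : ∀ k < W.card, ∃ x ∈ W, r x = k := by
    intro k hk
    have hinj : Set.InjOn r W := fun x hx y hy h =>
      le_antisymm ((hr' x hx y hy).2 h.le) ((hr' y hy x hx).2 h.ge)
    have := Finset.surjOn_of_injOn_of_card_le (s := W) (t := Finset.range W.card) r
      (fun x hx => by simpa using hrlt x hx) hinj (by simp)
    obtain ⟨x, hx, rfl⟩ := this (by simpa using hk)
    exact ⟨x, hx, rfl⟩
  have hpos : 0 < W.card := Finset.card_pos.2 ⟨_, hW _ le_rfl⟩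
  have hr0 : r (u (Sum.inl 0)) = 0 := by
    simp only [r, Finset.card_eq_zero, Finset.filter_eq_empty_iff]
    intro x hx
    exact not_lt.2 (Finset.mem_filter.1 hx).2
  let c : Fin n → ℕ := fun i => if u (Sum.inr i) < u (Sum.inl 0) then 0 else r (u (Sum.inr i)) + 1
  have hc : ∀ v, nodeLevel c v = if u v < u (Sum.inl 0) then 0 else r (u v) + 1 := by
    rintro (v | v)
    · rw [Subsingleton.elim v 0]
      simp [nodeLevel, hr0]
    · rfl
  refine ⟨c, mem_allLevels.2 ⟨W.card - 1, mem_levels.2 ⟨fun i => ?_, fun j hj2 hj => ?_⟩⟩, ?_⟩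
  · simp only [c]
    split_ifs with h
    · omega
    · have := hrlt _ (hW _ (not_lt.1 h))
      omega
  · obtain ⟨x, hx, hxj⟩ := hrsurj (j - 1) (by omega)
    obtain ⟨hx1, hx2⟩ := Finset.mem_filter.1 hx
    obtain ⟨v, -, rfl⟩ := Finset.mem_image.1 hx1
    rcases v with v | v
    · rw [Subsingleton.elim v 0, hr0] at hxj
      omega
    · exact ⟨v, by simp only [c, if_neg (not_lt.2 hx2)]; omega⟩
  · refine (dirFace_stellohedron_eq_iff _ _).2 fun i j => ?_
    simp only [Nat.cast_le, hc, lt_irrefl, if_false, hr0]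
    by_cases hi : u i < u (Sum.inl 0)
    · simp [hi]
    by_cases hj : u j < u (Sum.inl 0)
    · have : u j ≤ u i := by linarith
      simp [hi, hj, this, not_lt.1 hi]
    · have := hr' _ (hW j (not_lt.1 hj)) _ (hW i (not_lt.1 hi))
      simp [hi, hj, this, not_lt.1 hi]

theorem levelFace_one (n : ℕ) : levelFace (fun _ : Fin n => 1) = stellohedron n := by
  rw [← dirFace_zero (stellohedron n)]
  refine (dirFace_stellohedron_eq_iff _ _).2 fun i j => ?_
  have : ∀ v, nodeLevel (fun _ : Fin n => 1) v = 1 := by rintro (v | v) <;> rfl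
  simp [this]

theorem polyDim_stellohedron (n : ℕ) : polyDim (stellohedron n) = n := by
  have h : (fun _ : Fin n => 1) ∈ levels n 0 := mem_levels.2 ⟨by simp, fun j _ _ => by omega⟩
  have := polyDim_levelFace h
  rw [levelFace_one] at this
  simpa [zeros] using this

theorem ncard_facesOfDim_stellohedron (n k : ℕ) :
    (facesOfDim (stellohedron n) k).ncard =
      ((allLevels n).filter fun c => polyDim (levelFace c) = k).card := by
  classical
  have : facesOfDim (stellohedron n) k =
      ((((allLevels n).filter fun c => polyDim (levelFace c) = k).image levelFace : Finset _) :
        Set (Set (Fin 1 ⊕ Fin n → ℝ))) := by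
    ext F
    simp only [facesOfDim, Set.mem_ofPred_eq, Finset.coe_image, Finset.coe_filter, Set.mem_image]
    constructor
    · rintro ⟨hne, hexp, hdim⟩
      obtain ⟨u, rfl⟩ := (isExposed_iff_exists_dirFace hne).1 hexp
      obtain ⟨c, hc, h⟩ := exists_levelFace_eq u
      exact ⟨c, ⟨hc, by rw [h, hdim]⟩, h⟩
    · rintro ⟨c, ⟨hc, hdim⟩, rfl⟩
      have hne : (levelFace c).Nonempty :=
        dirFace_nestohedron_nonempty _ (graphicalBuildingSet (completeJoinEmpty 1 n))
      exact ⟨hne, (isExposed_iff_exists_dirFace hne).2 ⟨_, rfl⟩, hdim⟩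
  rw [this, Set.ncard_coe_finset, Finset.card_image_of_injOn]
  exact (levelFace_injOn n).mono (by exact_mod_cast Finset.filter_subset _ _)

/-! ### The face polynomials of the stellohedron -/

theorem fPoly_stellohedron (n : ℕ) :
    fPoly (stellohedron n) = MvPolynomial.aeval
      ![MvPolynomial.X 0 + 2 * MvPolynomial.X 1,
        (MvPolynomial.X 0 + MvPolynomial.X 1) * MvPolynomial.X 1] (galPoly n 0) := by
  rw [← sum_surjSum_eq_aeval_galPoly, fPoly, polyDim_stellohedron]
  have h1 : ∀ k ∈ Finset.range (n + 1),
      (MvPolynomial.C ((facesOfDim (stellohedron n) k).ncard : ℤ) *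
        MvPolynomial.X 0 ^ k * MvPolynomial.X 1 ^ (n - k) : MvPolynomial (Fin 2) ℤ) =
      ∑ c ∈ (allLevels n).filter fun c => polyDim (levelFace c) = k,
        MvPolynomial.X 0 ^ polyDim (levelFace c) *
          MvPolynomial.X 1 ^ (n - polyDim (levelFace c)) := by
    intro k _
    rw [Finset.sum_congr rfl fun c hc => by rw [(Finset.mem_filter.1 hc).2], Finset.sum_const,
      ncard_facesOfDim_stellohedron]
    simp [mul_assoc]
  rw [Finset.sum_congr rfl h1, Finset.sum_fiberwise_of_maps_to, sum_allLevels]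
  · refine Finset.sum_congr rfl fun m _ => ?_
    -- Multiplying by `α ^ m` allows `pow_mul_surjSum` to trade the weight `t` of new levels for the
    -- weight `α` that `levelSum` counts.
    have hX : (MvPolynomial.X 0 : MvPolynomial (Fin 2) ℤ) ^ m ≠ 0 :=
      pow_ne_zero _ (MvPolynomial.X_ne_zero _)
    refine mul_left_cancel₀ hX ?_
    have hs := levelSum_eq_surjSum (MvPolynomial.X 0 : MvPolynomial (Fin 2) ℤ)
      (MvPolynomial.X 1) n (Finset.Ico 2 (m + 2)) (by simp) (by simp)
    rw [Nat.card_Ico, Nat.add_sub_cancel] at hs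
    rw [pow_mul_surjSum, ← hs, levelSum, Finset.mul_sum, Finset.mul_sum]
    refine Finset.sum_congr rfl fun c hc => ?_
    have hd := polyDim_levelFace hc
    rw [prod_weight, show n - polyDim (levelFace c) = m + zeros c by omega,
      show n - zeros c = m + polyDim (levelFace c) by omega]
    ring
  · intro c hc
    obtain ⟨m, hm⟩ := mem_allLevels.1 hc
    have := polyDim_levelFace hm
    exact Finset.mem_range.2 (by omega)

/-- The substitution `α ↦ α - t` sends `α + 2t` to `α + t` and `(α + t)t` to `α t`. -/
theorem hPoly_stellohedron (n : ℕ) :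
    hPoly (stellohedron n) = MvPolynomial.aeval
      ![MvPolynomial.X 0 + MvPolynomial.X 1, MvPolynomial.X 0 * MvPolynomial.X 1]
      (galPoly n 0) := by
  rw [hPoly, fPoly_stellohedron]
  have := MvPolynomial.comp_aeval_apply (R := ℕ)
    (f := ![(MvPolynomial.X 0 + 2 * MvPolynomial.X 1 : MvPolynomial (Fin 2) ℤ),
        (MvPolynomial.X 0 + MvPolynomial.X 1) * MvPolynomial.X 1])
    ((MvPolynomial.aeval ![(MvPolynomial.X 0 - MvPolynomial.X 1 : MvPolynomial (Fin 2) ℤ),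
      MvPolynomial.X 1]).restrictScalars ℕ) (galPoly n 0)
  refine this.trans ?_
  congr 2
  ext1 i
  fin_cases i
  · simp [map_ofNat]
    ring
  · simp

/-! ### Gal's conjecture for the stellohedron -/

/-- With weights `1` for `a` and `2` for `b`, the monomials of weight `n` are exactly `a ^ (n - 2i)
* b ^ i`. -/
theorem galPoly_eq_sum (n : ℕ) :
    galPoly n 0 = ∑ i ∈ Finset.range (n / 2 + 1),
      MvPolynomial.monomial (Finsupp.single 0 (n - 2 * i) + Finsupp.single 1 i)
        ((galPoly n 0).coeff (Finsupp.single 0 (n - 2 * i) + Finsupp.single 1 i)) := by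
  ext p
  rw [MvPolynomial.coeff_sum]
  simp only [MvPolynomial.coeff_monomial]
  have hiff : ∀ i ∈ Finset.range (n / 2 + 1),
      ((Finsupp.single 0 (n - 2 * i) + Finsupp.single 1 i : Fin 2 →₀ ℕ) = p ↔
        p 0 + 2 * p 1 = n ∧ i = p 1) := by
    intro i hi
    rw [Finset.mem_range] at hi
    rw [Finsupp.ext_iff, Fin.forall_fin_two]
    simp only [Finsupp.add_apply, Finsupp.single_apply]
    simp
    omega
  rw [Finset.sum_congr rfl fun i hi => if_congr (hiff i hi) rfl rfl]
  by_cases hp : p 0 + 2 * p 1 = n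
  · have hmem : p 1 ∈ Finset.range (n / 2 + 1) := Finset.mem_range.2 (by omega)
    have := (hiff _ hmem).2 ⟨hp, rfl⟩
    simp only [hp, true_and]
    rw [Finset.sum_ite_eq', if_pos hmem, this]
  · simp only [hp, false_and, if_false, Finset.sum_const_zero]
    by_contra hne
    have := galPoly_isWeightedHomogeneous n 0 hne
    rw [Finsupp.weight_apply, Finsupp.sum_fintype _ _ (by simp)] at this
    simp at this
    omega

/-- The coefficients of the `γ`-polynomial of the `n`-dimensional stellohedron. -/
def stelloGamma (n i : ℕ) : ℕ :=
  (galPoly n 0).coeff (Finsupp.single 0 (n - 2 * i) + Finsupp.single 1 i)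

theorem hPoly_stellohedron_eq_sum (n : ℕ) :
    hPoly (stellohedron n) = ∑ i ∈ Finset.range (n / 2 + 1),
      MvPolynomial.C (stelloGamma n i : ℤ) * (MvPolynomial.X 0 * MvPolynomial.X 1) ^ i *
        (MvPolynomial.X 0 + MvPolynomial.X 1) ^ (n - 2 * i) := by
  rw [hPoly_stellohedron, galPoly_eq_sum, map_sum]
  refine Finset.sum_congr rfl fun i _ => ?_
  rw [MvPolynomial.aeval_monomial, Finsupp.prod_fintype _ _ (by simp)]
  simp [stelloGamma]
  ring

theorem satisfiesGal_stellohedron (n : ℕ) : SatisfiesGal (stellohedron n) := by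
  have hcoeff : ∀ i, (∑ j ∈ Finset.range (n / 2 + 1),
      Polynomial.monomial j (stelloGamma n j : ℤ)).coeff i =
        if i ∈ Finset.range (n / 2 + 1) then (stelloGamma n i : ℤ) else 0 := by
    intro i
    rw [Polynomial.finsetSum_coeff]
    simp only [Polynomial.coeff_monomial]
    rw [Finset.sum_ite_eq']
  refine ⟨∑ j ∈ Finset.range (n / 2 + 1), Polynomial.monomial j (stelloGamma n j : ℤ),
    ⟨?_, ?_⟩, fun i => ?_⟩
  · rw [polyDim_stellohedron]
    have : (∑ j ∈ Finset.range (n / 2 + 1),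
        Polynomial.monomial j (stelloGamma n j : ℤ)).natDegree ≤ n / 2 := by
      rw [Polynomial.natDegree_le_iff_coeff_eq_zero]
      intro i hi
      rw [hcoeff, if_neg (by rw [Finset.mem_range]; omega)]
    omega
  · rw [polyDim_stellohedron, hPoly_stellohedron_eq_sum]
    exact Finset.sum_congr rfl fun i hi => by rw [hcoeff, if_pos hi]
  · rw [hcoeff]
    split_ifs <;> positivity

/-! ### Generating series -/

/-- The coefficient of `x ^ n` of `St_h`, written in `a = α + t` and `b = α t`. -/
def stelloCoeffAB (n : ℕ) : MvPolynomial (Fin 2) ℚ :=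
  MvPolynomial.C (1 / (n ! : ℚ)) * MvPolynomial.map (Nat.castRingHom ℚ) (galPoly n 0)

theorem aeval_stelloCoeffAB (n : ℕ) :
    MvPolynomial.aeval (R := ℚ)
      ![(MvPolynomial.X 0 + MvPolynomial.X 1 : MvPolynomial (Fin 2) ℚ),
        MvPolynomial.X 0 * MvPolynomial.X 1] (stelloCoeffAB n) = stelloCoeff n := by
  rw [stelloCoeffAB, stelloCoeff, hPoly_stellohedron, map_mul, MvPolynomial.aeval_C]
  refine congrArg₂ (· * ·) rfl ?_
  induction galPoly n 0 using MvPolynomial.induction_on with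
  | C a => simp
  | add p q hp hq => rw [map_add, map_add, map_add, map_add, hp, hq]
  | mul_X p i hp =>
    rw [map_mul, map_mul, map_mul, map_mul, hp]
    fin_cases i <;> simp

theorem coeff_stelloCoeffAB_nonneg (n : ℕ) (p : Fin 2 →₀ ℕ) :
    0 ≤ (stelloCoeffAB n).coeff p := by
  rw [stelloCoeffAB, MvPolynomial.coeff_C_mul, MvPolynomial.coeff_map]
  exact mul_nonneg (by positivity) (by simp)

theorem stelloCoeff_symmetric (n : ℕ) :
    MvPolynomial.rename (R := ℚ) (Equiv.swap (0 : Fin 2) 1) (stelloCoeff n) = stelloCoeff n := by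
  rw [← aeval_stelloCoeffAB, ← AlgHom.comp_apply]
  congr 1
  ext1 i
  fin_cases i <;> simp [add_comm, mul_comm]

theorem stelloCoeff_isHomogeneous (n : ℕ) : (stelloCoeff n).IsHomogeneous n := by
  rw [stelloCoeff, hPoly_stellohedron_eq_sum]
  refine .C_mul (.map (.sum _ _ _ fun i hi => ?_) _) _
  have hX (i : Fin 2) := MvPolynomial.isHomogeneous_X ℤ i
  have := ((((hX 0).mul (hX 1)).pow i).mul (((hX 0).add (hX 1)).pow (n - 2 * i))).C_mul
    (stelloGamma n i : ℤ)
  rw [← mul_assoc] at this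
  convert this using 1
  rw [Finset.mem_range] at hi
  omega

/-- Serves both series: `d` counts the extra variables in each monomial, `0` for `St_h` and `1` (the
factor `y`) for the two-variable series. The series then has degree `2d`. -/
theorem isGalSeries_of_coeff {σ : Type*} {ψ : MvPowerSeries σ (MvPolynomial (Fin 2) ℚ)}
    (s : (σ →₀ ℕ) → Prop) [DecidablePred s] (k : (σ →₀ ℕ) → ℕ) (d : ℕ)
    (hk : ∀ m, s m → m.degree = k m + d)
    (hψ : ∀ m, MvPowerSeries.coeff m ψ = if s m then stelloCoeff (k m) else 0) :
    IsGalSeries ψ where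
  symmetric := by
    ext1 m
    rw [MvPowerSeries.coeff_map, hψ]
    split_ifs
    · exact stelloCoeff_symmetric _
    · exact map_zero _
  homogeneous := by
    refine ⟨2 * d, fun m p h => ?_⟩
    rw [hψ] at h
    split_ifs at h with hm
    · have h1 := hk m hm
      have h2 : p.degree = k m := by
        rw [Finsupp.degree_eq_weight_one (R := ℕ)]
        exact stelloCoeff_isHomogeneous _ h
      omega
    · exact absurd (MvPolynomial.coeff_zero p) h
  nonneg := by
    let ψ' : MvPowerSeries σ (MvPolynomial (Fin 2) ℚ) :=
      fun m => if s m then stelloCoeffAB (k m) else 0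
    have hψ' : ∀ m, MvPowerSeries.coeff m ψ' = if s m then stelloCoeffAB (k m) else 0 :=
      fun _ => rfl
    refine ⟨ψ', ?_, fun m p => ?_⟩
    · ext1 m
      rw [MvPowerSeries.coeff_map, hψ, hψ']
      split_ifs
      · exact aeval_stelloCoeffAB _
      · exact map_zero _
    · rw [hψ']
      split_ifs
      · exact coeff_stelloCoeffAB_nonneg _ _
      · simp

theorem isGalSeries_stelloSeries : IsGalSeries (σ := Unit) stelloSeries :=
  isGalSeries_of_coeff (fun _ => True) (fun m => m ()) 0
    (fun m _ => by simp [Finsupp.degree_eq_sum]) fun m => (if_pos trivial).symm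

theorem isGalSeries_stelloSeriesXY : IsGalSeries stelloSeriesXY := by
  refine isGalSeries_of_coeff (fun m => m 1 = 1) (fun m => m 0) 1
    (fun m hm => by rw [Finsupp.degree_eq_sum, Fin.sum_univ_two, hm]) fun m => ?_
  change (if m 1 = 1 then _ else _) = _
  refine if_ctx_congr Iff.rfl (fun hm => ?_) fun _ => rfl
  rw [hm, stelloCoeff, stellohedron]
  simp

end

end Nestohedra

theorem mainTheorem7 :
    Nestohedra.IsGalSeries Nestohedra.stelloSeriesXY ∧
    Nestohedra.IsGalSeries (σ := Unit) Nestohedra.stelloSeries ∧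
    ∀ n : ℕ, Nestohedra.SatisfiesGal (Nestohedra.stellohedron n) :=
  ⟨Nestohedra.isGalSeries_stelloSeriesXY, Nestohedra.isGalSeries_stelloSeries,
    Nestohedra.satisfiesGal_stellohedron⟩
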